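/- There exist universal constants $C_1,C_2>0$ such that the following holds for every integer $n\ge 1$. Let $\alpha_1,\alpha_2\ge 0$ be real numbers, $\mu_\star\in\mathbb{R}$ and $Z_\star\in\mathbb{R}^{n\times n}$ with $|\mu_\star|\le\alpha_1$, $\|Z_\star\|_\infty:=\max_{i,j}|Z_{\star,ij}|\le\alpha_2$ and $\mathbf 1_n^{T}Z_\star\mathbf 1_n=0$. Put $J=\mathbf 1_n\mathbf 1_n^{T}$, $M_\star=\mu_\star J+Z_\star$, $r=\operatorname{rank}(Z_\star)$, $\alpha_0=\alpha_1+\alpha_2$ and $f(m)=e^m/(1+e^m)$. Let $W=(w_{ij})$ be an $n\times n$ matrix of mutually independent Bernoulli random variables with $\Pr(w_{ij}=1)=f(m_{\star,ij})$. For $M\in\mathbb{R}^{n\times n}$ let $$\ell_W(M)=\sum_{i,j}\big[\mathbb 1_{[w_{ij}=1]}\log f(m_{ij})+\mathbb 1_{[w_{ij}=0]}\log\{1-f(m_{ij})\}\big],$$ and let $(\hat\mu,\hat Z)$ be a maximizer of $\ell_W(\mu J+Z)$ over all $(\mu,Z)\in\mathbb{R}\times\mathbb{R}^{n\times n}$ with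 $$|\mu|\le\alpha_1,\qquad \|Z\|_\infty\le\alpha_2,\qquad \|Z\|_*\le\alpha_2\, r^{1/2} n,\qquad \mathbf 1_n^{T}Z\mathbf 1_n=0,$$ where $\|\cdot\|_*$ is the nuclear norm. Put $\hat M=\hat\mu J+\hat Z$. Then, with probability at least $1-C_1/n$, all three of the following bounds hold: $$(\mu_\star-\hat\mu)^2\le C_2(\alpha_1^2\wedge\Gamma_n),\qquad \frac{1}{n^2}\|\hat Z-Z_\star\|_F^2\le C_2(\alpha_2^2\wedge\Gamma_n),\qquad \frac{1}{n^2}\|\hat M-M_\star\|_F^2\le C_2(\alpha_0^2\wedge\Gamma_n),$$ where $\Gamma_n=e^{\alpha_0}(\alpha_1+\alpha_2 r^{1/2})n^{-1/2}$. -/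

import Mathlib

open MeasureTheory ProbabilityTheory
open scoped Matrix.Norms.Frobenius

noncomputable section

namespace LowRankMissing

/-- The nuclear norm: the sum of the singular values. -/
def nuclearNorm {n₁ n₂ : ℕ} (A : Matrix (Fin n₁) (Fin n₂) ℝ) : ℝ :=
  ∑ k : Fin n₂, (Matrix.toEuclideanLin A).singularValues (k : ℕ)

/-- The linear predictor `μ J + Z`, where `J` is the all-ones matrix. -/
def predictor {n₁ n₂ : ℕ} (μ : ℝ) (Z : Matrix (Fin n₁) (Fin n₂) ℝ) :
    Matrix (Fin n₁) (Fin n₂) ℝ :=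
  μ • Matrix.of (fun _ _ => 1) + Z

/-- The log-likelihood of `M` given the indicator matrix `W`, for the inverse link `f`. -/
def logLik {n₁ n₂ : ℕ} (f : ℝ → ℝ) (W M : Matrix (Fin n₁) (Fin n₂) ℝ) : ℝ :=
  ∑ i, ∑ j, ((if W i j = 1 then Real.log (f (M i j)) else 0) +
    (if W i j = 0 then Real.log (1 - f (M i j)) else 0))

/-- Pairs `(μ, Z)` with `|μ| ≤ α₁`, `‖Z‖_∞ ≤ α₂` (maximum norm) and entries of `Z` summing to 0. -/
def paramSet (n₁ n₂ : ℕ) (α₁ α₂ : ℝ) : Set (ℝ × Matrix (Fin n₁) (Fin n₂) ℝ) :=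
  {p | |p.1| ≤ α₁ ∧ (∀ i j, |p.2 i j| ≤ α₂) ∧ ∑ i, ∑ j, p.2 i j = 0}

/-- Pairs in `paramSet` that also satisfy `‖Z‖_* ≤ α₂ √(r n₁ n₂)`. -/
def constrainedParamSet (n₁ n₂ r : ℕ) (α₁ α₂ : ℝ) :
    Set (ℝ × Matrix (Fin n₁) (Fin n₂) ℝ) :=
  {p | p ∈ paramSet n₁ n₂ α₁ α₂ ∧ nuclearNorm p.2 ≤ α₂ * √((r : ℝ) * n₁ * n₂)}

/-- `(μ, Z)` maximizes the log-likelihood over `constrainedParamSet n₁ n₂ r α₁ α₂`. -/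
def IsConstrainedMLE {n₁ n₂ : ℕ} (f : ℝ → ℝ) (W : Matrix (Fin n₁) (Fin n₂) ℝ)
    (r : ℕ) (α₁ α₂ : ℝ) (μ : ℝ) (Z : Matrix (Fin n₁) (Fin n₂) ℝ) : Prop :=
  (μ, Z) ∈ constrainedParamSet n₁ n₂ r α₁ α₂ ∧
    IsMaxOn (fun p : ℝ × Matrix (Fin n₁) (Fin n₂) ℝ => logLik f W (predictor p.1 p.2))
      (constrainedParamSet n₁ n₂ r α₁ α₂) (μ, Z)

/-- The rate `Γₙ = exp (α₁ + α₂) (α₁ + α₂ √r) / √n`. -/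
def gammaRate (n r : ℕ) (α₁ α₂ : ℝ) : ℝ :=
  Real.exp (α₁ + α₂) * (α₁ + α₂ * √(r : ℝ)) / √(n : ℝ)

end LowRankMissing

end

/-! The negative log-likelihood has curvature at least `exp (-α₀) / 4` on `[-α₀, α₀]`, where `α₀ =
α₁ + α₂`. The truth is feasible (`mem_constrainedParamSet_rank`), so optimality bounds the squared
Frobenius error by `8 exp α₀` times the pairing of the noise `W - σ(M⋆)` with the error
(`frobenius_norm_sq_le_of_logLik_le`).

Trace duality bounds that pairing by the operator norm of the noise times `2 n (α₁ + α₂ √r)`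
(`sum_mul_predictor_sub_le`). A net argument with Hoeffding's inequality gives operator norm at most
`8 √n` outside probability `exp (-n) ≤ 1 / n` (`measure_opNorm_gt_le`). Zero-sum matrices are
orthogonal to `J`, so the bound on the total error passes to `μ` and `Z` separately; the other
halves of the minima come from the entrywise constraints. -/

namespace LowRankMissing

/-! ### Singular values and trace duality -/

section TraceDuality

variable {n₁ n₂ : ℕ}

/-- Both sides are the trace of `XᵀA`, which any orthonormal basis computes. -/
theorem sum_mul_eq_sum_inner {ι : Type*} [Fintype ι] (X A : Matrix (Fin n₁) (Fin n₂) ℝ)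
    (b : OrthonormalBasis ι ℝ (EuclideanSpace ℝ (Fin n₂))) :
    ∑ i, ∑ j, X i j * A i j =
      ∑ k, inner ℝ (Matrix.toEuclideanLin X (b k)) (Matrix.toEuclideanLin A (b k)) := by
  have key : ∀ {κ : Type _} [Fintype κ] (c : OrthonormalBasis κ ℝ (EuclideanSpace ℝ (Fin n₂))),
      ∑ k, inner ℝ (Matrix.toEuclideanLin X (c k)) (Matrix.toEuclideanLin A (c k)) =
        LinearMap.trace ℝ _ ((Matrix.toEuclideanLin X).adjoint ∘ₗ Matrix.toEuclideanLin A) := by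
    intro κ _ c
    rw [LinearMap.trace_eq_sum_inner _ c]
    simp [LinearMap.adjoint_inner_right]
  rw [key b, LinearMap.trace_eq_sum_inner _ (EuclideanSpace.basisFun (Fin n₂) ℝ),
    Finset.sum_comm]
  refine Finset.sum_congr rfl fun k _ => ?_
  simp [LinearMap.adjoint_inner_right, Matrix.toLpLin_apply, PiLp.inner_apply, mul_comm]

theorem exists_orthonormalBasis_norm_eq_singularValues (A : Matrix (Fin n₁) (Fin n₂) ℝ) :
    ∃ b : OrthonormalBasis (Fin n₂) ℝ (EuclideanSpace ℝ (Fin n₂)), ∀ k,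
      ‖Matrix.toEuclideanLin A (b k)‖ = (Matrix.toEuclideanLin A).singularValues (k : ℕ) := by
  set T := Matrix.toEuclideanLin A
  have hn : Module.finrank ℝ (EuclideanSpace ℝ (Fin n₂)) = n₂ := by simp
  refine ⟨T.isSymmetric_adjoint_comp_self.eigenvectorBasis hn, fun k => ?_⟩
  refine (sq_eq_sq₀ (norm_nonneg _) (T.singularValues_nonneg _)).1 ?_
  rw [T.sq_singularValues_fin hn, ← real_inner_self_eq_norm_sq, ← LinearMap.adjoint_inner_right,
    ← LinearMap.comp_apply, T.isSymmetric_adjoint_comp_self.apply_eigenvectorBasis hn]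
  simp [inner_smul_right]

/-- Trace duality between the operator norm and the nuclear norm. -/
theorem sum_mul_le_mul_nuclearNorm (X A : Matrix (Fin n₁) (Fin n₂) ℝ) {K : ℝ}
    (hX : ∀ v, ‖Matrix.toEuclideanLin X v‖ ≤ K * ‖v‖) :
    |∑ i, ∑ j, X i j * A i j| ≤ K * nuclearNorm A := by
  obtain ⟨b, hb⟩ := exists_orthonormalBasis_norm_eq_singularValues A
  rw [sum_mul_eq_sum_inner X A b, nuclearNorm, Finset.mul_sum]
  refine (Finset.abs_sum_le_sum_abs _ _).trans (Finset.sum_le_sum fun k _ => ?_)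
  refine (abs_real_inner_le_norm _ _).trans ?_
  rw [hb]
  gcongr
  · exact LinearMap.singularValues_nonneg _ _
  · simpa using hX (b k)

theorem frobenius_norm_sq (A : Matrix (Fin n₁) (Fin n₂) ℝ) :
    ‖A‖ ^ 2 = ∑ i, ∑ j, A i j ^ 2 := by
  have h : (0 : ℝ) ≤ ∑ i, ∑ j, A i j ^ 2 := by positivity
  rw [Matrix.frobenius_norm_def, ← Real.sqrt_eq_rpow]
  simp [Real.sq_sqrt h]

/-- Cauchy–Schwarz over the nonzero singular values, of which there are at most `rank A`. -/
theorem nuclearNorm_sq_le (A : Matrix (Fin n₁) (Fin n₂) ℝ) :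
    nuclearNorm A ^ 2 ≤ A.rank * ‖A‖ ^ 2 := by
  obtain ⟨b, hb⟩ := exists_orthonormalBasis_norm_eq_singularValues A
  have hF : ‖A‖ ^ 2 = ∑ k : Fin n₂, (Matrix.toEuclideanLin A).singularValues (k : ℕ) ^ 2 := by
    simp_rw [frobenius_norm_sq, pow_two (A _ _), sum_mul_eq_sum_inner A A b,
      real_inner_self_eq_norm_sq, hb]
  have hr : A.rank = Module.finrank ℝ (Matrix.toEuclideanLin A).range := by
    rw [show Matrix.toEuclideanLin A = _ from congr($(Matrix.toLpLin_eq_toLin 2 2) A),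
      ← Matrix.rank_eq_finrank_range_toLin]
  set s := (Matrix.toEuclideanLin A).singularValues
  set S : Finset (Fin n₂) := {k | s (k : ℕ) ≠ 0}
  have hS : S.card ≤ A.rank := by
    rw [hr, ← LinearMap.card_support_singularValues]
    refine Finset.card_le_card_of_injOn (fun k : Fin n₂ => (k : ℕ)) ?_
      (fun a _ b _ h => Fin.ext h)
    intro k hk
    exact Finset.mem_coe.2 (Finsupp.mem_support_iff.2 (Finset.mem_filter.1 hk).2)
  have h1 : nuclearNorm A = ∑ k ∈ S, s (k : ℕ) := by
    rw [nuclearNorm, Finset.sum_filter_ne_zero]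
  rw [h1, hF]
  refine sq_sum_le_card_mul_sum_sq.trans ?_
  gcongr
  exact Finset.subset_univ _

end TraceDuality

/-! ### Nets and operator norms -/

section Net

variable {E F : Type*} [NormedAddCommGroup E] [NormedSpace ℝ E]
  [NormedAddCommGroup F] [InnerProductSpace ℝ F]

/-- The unit ball of a finite-dimensional space has a `1/2`-net with at most `5 ^ dim` points. -/
theorem exists_half_net (E : Type*) [NormedAddCommGroup E] [NormedSpace ℝ E]
    [FiniteDimensional ℝ E] :
    ∃ N : Finset E, N.card ≤ 5 ^ Module.finrank ℝ E ∧ (∀ u ∈ N, ‖u‖ ≤ 1) ∧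
      ∀ y : E, ‖y‖ ≤ 1 → ∃ u ∈ N, ‖y - u‖ ≤ 1 / 2 := by
  classical
  -- A `1/2`-separated subset of the ball of maximal cardinality is a net. Scaling by 2 fits the
  -- packing bound for 1-separated points in the ball of radius 2.
  let Q : Finset E → Prop := fun N =>
    (∀ u ∈ N, ‖u‖ ≤ 1) ∧ ∀ u ∈ N, ∀ v ∈ N, u ≠ v → 1 / 2 ≤ ‖u - v‖
  have hcard : ∀ N, Q N → N.card ≤ 5 ^ Module.finrank ℝ E := by
    intro N hN
    have hinj : Function.Injective fun u : E => (2 : ℝ) • u := smul_right_injective E two_ne_zero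
    rw [← Finset.card_image_of_injective N hinj]
    refine Besicovitch.card_le_of_separated _ ?_ ?_
    · simp only [Finset.forall_mem_image, norm_smul]
      intro u hu
      have := hN.1 u hu
      norm_num
      linarith
    · simp only [Finset.forall_mem_image]
      intro u hu v hv huv
      have := hN.2 u hu v hv (fun h => huv (by rw [h]))
      rw [← smul_sub, norm_smul]
      norm_num
      linarith
  obtain ⟨m, ⟨N, hN, rfl⟩, hmax⟩ : ∃ m, IsGreatest {m | ∃ N, Q N ∧ N.card = m} m := by
    have hne : {m | ∃ N, Q N ∧ N.card = m}.Nonempty := ⟨0, ∅, by simp [Q], rfl⟩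
    have hbdd : BddAbove {m | ∃ N, Q N ∧ N.card = m} := by
      refine ⟨5 ^ Module.finrank ℝ E, ?_⟩
      rintro m ⟨N, hN, rfl⟩
      exact hcard N hN
    exact ⟨_, Nat.sSup_mem hne hbdd, fun m hm => le_csSup hbdd hm⟩
  refine ⟨N, hcard N hN, hN.1, fun y hy => ?_⟩
  by_contra! hfar
  have hyN : y ∉ N := fun h => by
    have := hfar y h
    norm_num at this
  have hQ : Q (insert y N) := by
    constructor
    · simpa using ⟨hy, hN.1⟩
    · intro u hu v hv huv
      rcases Finset.mem_insert.1 hu with hu | hu <;> rcases Finset.mem_insert.1 hv with hv | hv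
      · exact absurd (hu.trans hv.symm) huv
      · rw [hu]; exact (hfar v hv).le
      · rw [hv, norm_sub_rev]; exact (hfar u hu).le
      · exact hN.2 u hu v hv huv
  have := hmax ⟨_, hQ, rfl⟩
  rw [Finset.card_insert_of_notMem hyN] at this
  omega

theorem norm_le_of_half_net {N : Finset F}
    (hN : ∀ y : F, ‖y‖ ≤ 1 → ∃ u ∈ N, ‖y - u‖ ≤ 1 / 2) {t : ℝ} {y : F}
    (h : ∀ u ∈ N, inner ℝ u y ≤ t) : ‖y‖ ≤ 2 * t := by
  rcases eq_or_ne y 0 with rfl | hy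
  · obtain ⟨u, hu, -⟩ := hN 0 (by simp)
    simpa using h u hu
  have hy' : 0 < ‖y‖ := norm_pos_iff.2 hy
  obtain ⟨u, hu, hyu⟩ := hN (‖y‖⁻¹ • y) (by simp [norm_smul, hy'.ne'])
  have h1 : inner ℝ (‖y‖⁻¹ • y) y = ‖y‖ := by
    rw [real_inner_smul_left, real_inner_self_eq_norm_sq]
    field_simp
  have h2 : inner ℝ (‖y‖⁻¹ • y - u) y ≤ 1 / 2 * ‖y‖ :=
    (real_inner_le_norm _ _).trans (by gcongr)
  rw [inner_sub_left, h1] at h2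
  linarith [h u hu]

theorem opNorm_le_of_half_nets {N : Finset E} {N' : Finset F}
    (hN : ∀ y : E, ‖y‖ ≤ 1 → ∃ u ∈ N, ‖y - u‖ ≤ 1 / 2)
    (hN' : ∀ y : F, ‖y‖ ≤ 1 → ∃ u ∈ N', ‖y - u‖ ≤ 1 / 2) {t : ℝ} (T : E →L[ℝ] F)
    (h : ∀ u ∈ N', ∀ v ∈ N, inner ℝ u (T v) ≤ t) : ‖T‖ ≤ 4 * t := by
  have hT : ∀ v ∈ N, ‖T v‖ ≤ 2 * t := fun v hv => norm_le_of_half_net hN' fun u hu => h u hu v hv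
  have hunit : ∀ v : E, ‖v‖ ≤ 1 → ‖T v‖ ≤ 2 * t + ‖T‖ / 2 := by
    intro v hv
    obtain ⟨u, hu, hvu⟩ := hN v hv
    have h1 : ‖T (v - u)‖ ≤ ‖T‖ * (1 / 2) := (T.le_opNorm _).trans (by gcongr)
    have h2 : T v = T u + T (v - u) := by simp
    rw [h2]
    linarith [norm_add_le (T u) (T (v - u)), hT u hu]
  have h0 : 0 ≤ 2 * t + ‖T‖ / 2 := by simpa using hunit 0 (by simp)
  have := T.opNorm_le_of_unit_norm h0 fun v hv => hunit v hv.le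
  linarith

end Net

/-! ### Curvature of the logistic loss -/

section Logistic

theorem hasDerivAt_log_one_add_exp (m : ℝ) :
    HasDerivAt (fun m => Real.log (1 + Real.exp m)) (Real.sigmoid m) m := by
  have h : HasDerivAt (fun m => 1 + Real.exp m) (Real.exp m) m := (Real.hasDerivAt_exp m).const_add 1
  convert! h.log (by positivity) using 1
  rw [Real.sigmoid_def, Real.exp_neg]
  field_simp
  ring

theorem log_sigmoid (m : ℝ) : Real.log (Real.sigmoid m) = m - Real.log (1 + Real.exp m) := by
  have h : Real.sigmoid m = Real.exp m / (1 + Real.exp m) := by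
    rw [Real.sigmoid_def, Real.exp_neg]
    field_simp
    ring
  rw [h, Real.log_div (by positivity) (by positivity), Real.log_exp]

theorem log_one_sub_sigmoid (m : ℝ) :
    Real.log (1 - Real.sigmoid m) = -Real.log (1 + Real.exp m) := by
  rw [← Real.sigmoid_neg, Real.sigmoid_def, neg_neg, Real.log_inv]

theorem exp_neg_le_sigmoid_mul_one_sub_sigmoid {a m : ℝ} (hm : |m| ≤ a) :
    Real.exp (-a) / 4 ≤ Real.sigmoid m * (1 - Real.sigmoid m) := by
  obtain ⟨h1, h2⟩ := abs_le.1 hm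
  have e1 : Real.exp m ≤ Real.exp a := Real.exp_le_exp.2 h2
  have e2 : Real.exp (-m) ≤ Real.exp a := Real.exp_le_exp.2 (by linarith)
  have e3 : 1 ≤ Real.exp a := Real.one_le_exp (by linarith)
  have e4 : Real.exp m * Real.exp (-m) = 1 := by rw [← Real.exp_add]; simp
  rw [← Real.sigmoid_neg, Real.sigmoid_def, Real.sigmoid_def, neg_neg, ← mul_inv, Real.exp_neg a,
    div_eq_mul_inv, ← mul_inv]
  refine inv_anti₀ (by positivity) ?_
  nlinarith

theorem log_one_add_exp_strong_convexity {a x y : ℝ} (hx : |x| ≤ a) (hy : |y| ≤ a) :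
    Real.exp (-a) / 8 * (y - x) ^ 2 ≤
      Real.log (1 + Real.exp y) - Real.log (1 + Real.exp x) - Real.sigmoid x * (y - x) := by
  -- Since `2 c` is the lower bound on the second derivative, subtracting `c m²` leaves a convex
  -- function; the claim is its tangent-line inequality at `x`.
  set c := Real.exp (-a) / 8 with hc
  set g : ℝ → ℝ := fun m => Real.log (1 + Real.exp m) - c * m ^ 2
  have hg : ∀ m, HasDerivAt g (Real.sigmoid m - 2 * c * m) m := fun m => by
    convert! (hasDerivAt_log_one_add_exp m).sub ((hasDerivAt_pow 2 m).const_mul c) using 1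
    simp
    ring
  have hg' : ∀ m, HasDerivAt (fun m => Real.sigmoid m - 2 * c * m)
      (Real.sigmoid m * (1 - Real.sigmoid m) - 2 * c) m := fun m => by
    convert! (Real.hasDerivAt_sigmoid m).sub ((hasDerivAt_id m).const_mul (2 * c)) using 1
    simp
  have hd : deriv g = fun m => Real.sigmoid m - 2 * c * m := funext fun m => (hg m).deriv
  have hconv : ConvexOn ℝ (Set.Icc (-a) a) g := by
    refine convexOn_of_deriv2_nonneg (convex_Icc _ _)
      (fun m _ => (hg m).continuousAt.continuousWithinAt)
      (fun m _ => (hg m).differentiableAt.differentiableWithinAt) ?_ ?_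
    · rw [hd]
      exact fun m _ => (hg' m).differentiableAt.differentiableWithinAt
    · intro m hm
      rw [Function.iterate_succ, Function.iterate_one, Function.comp_apply, hd, (hg' m).deriv]
      have := exp_neg_le_sigmoid_mul_one_sub_sigmoid (abs_le.2 (Set.mem_Icc.1 (interior_subset hm)))
      rw [hc]
      linarith
  have key : g x + (Real.sigmoid x - 2 * c * x) * (y - x) ≤ g y := by
    rcases lt_trichotomy x y with h | rfl | h
    · have := hconv.le_slope_of_hasDerivAt (abs_le.1 hx) (abs_le.1 hy) h (hg x)
      rw [slope_def_field, le_div_iff₀ (by linarith)] at this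
      linarith
    · simp
    · have := hconv.slope_le_of_hasDerivAt (abs_le.1 hy) (abs_le.1 hx) h (hg x)
      rw [slope_def_field, div_le_iff₀ (by linarith)] at this
      linarith
  simp only [g] at key
  nlinarith

end Logistic

/-! ### Deviation of the noise matrix -/

section Deviation

theorem _root_.ProbabilityTheory.HasSubgaussianMGF.mono {Ω : Type*} [MeasurableSpace Ω]
    {P : Measure Ω} {X : Ω → ℝ} {c d : NNReal} (h : HasSubgaussianMGF X c P) (hcd : c ≤ d) :
    HasSubgaussianMGF X d P where
  integrable_exp_mul := h.integrable_exp_mul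
  mgf_le t := (h.mgf_le t).trans (by gcongr)

variable {Ω : Type*} [MeasurableSpace Ω] {P : Measure Ω} {n₁ n₂ n : ℕ}

/-- Hoeffding bound for a bilinear form in a matrix with independent sub-Gaussian entries. -/
theorem measure_inner_ge_le {X : Ω → Matrix (Fin n₁) (Fin n₂) ℝ}
    (hind : iIndepFun (fun (k : Fin n₁ × Fin n₂) (ω : Ω) => X ω k.1 k.2) P)
    {c : NNReal} (hsub : ∀ i j, HasSubgaussianMGF (fun ω => X ω i j) c P)
    {u : EuclideanSpace ℝ (Fin n₁)} {v : EuclideanSpace ℝ (Fin n₂)} (hu : ‖u‖ ≤ 1) (hv : ‖v‖ ≤ 1)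
    {t : ℝ} (ht : 0 ≤ t) :
    P.real {ω | t ≤ inner ℝ u (Matrix.toEuclideanLin (X ω) v)} ≤ Real.exp (-t ^ 2 / (2 * c)) := by
  have hterm : ∀ k ∈ (Finset.univ : Finset (Fin n₁ × Fin n₂)),
      HasSubgaussianMGF (fun ω => u k.1 * v k.2 * X ω k.1 k.2)
        (((u k.1 * v k.2) ^ 2).toNNReal * c) P := by
    refine fun k _ => ((hsub k.1 k.2).const_mul _).mono (mul_le_mul_left (le_of_eq ?_) _)
    exact (Real.toNNReal_of_nonneg (sq_nonneg _)).symm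
  have hind' : iIndepFun (fun (k : Fin n₁ × Fin n₂) (ω : Ω) => u k.1 * v k.2 * X ω k.1 k.2) P :=
    hind.comp (fun k x => u k.1 * v k.2 * x) fun k => measurable_const_mul _
  have hsum := HasSubgaussianMGF.sum_of_iIndepFun hind' hterm
  -- The squared coefficients sum to `‖u‖² ‖v‖² ≤ 1`.
  have hle : ∑ k : Fin n₁ × Fin n₂, ((u k.1 * v k.2) ^ 2).toNNReal * c ≤ c := by
    rw [← Finset.sum_mul]
    refine mul_le_of_le_one_left' ?_
    rw [← NNReal.coe_le_coe]
    push_cast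
    simp_rw [Real.coe_toNNReal _ (sq_nonneg _)]
    have h : ∑ k : Fin n₁ × Fin n₂, (u k.1 * v k.2) ^ 2 = ‖u‖ ^ 2 * ‖v‖ ^ 2 := by
      simp_rw [EuclideanSpace.real_norm_sq_eq, Finset.sum_mul_sum, mul_pow, Fintype.sum_prod_type]
    refine h.trans_le (mul_le_one₀ ?_ (by positivity) ?_) <;> exact pow_le_one₀ (norm_nonneg _) ‹_›
  have hinner : ∀ ω, inner ℝ u (Matrix.toEuclideanLin (X ω) v) =
      ∑ k : Fin n₁ × Fin n₂, u k.1 * v k.2 * X ω k.1 k.2 := by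
    intro ω
    simp only [PiLp.inner_apply, Matrix.toLpLin_apply, Matrix.mulVec, dotProduct,
      Fintype.sum_prod_type, RCLike.inner_apply, conj_trivial, Finset.sum_mul]
    exact Finset.sum_congr rfl fun i _ => Finset.sum_congr rfl fun j _ => by ring
  simp_rw [hinner]
  exact (hsum.mono hle).measure_ge_le ht

/-- A square matrix with independent centred entries of sub-Gaussian parameter `1/4` has operator norm
at most `8 √n` outside an event of probability `exp (-n)`. -/
theorem measure_opNorm_gt_le [IsProbabilityMeasure P] {X : Ω → Matrix (Fin n) (Fin n) ℝ}
    (hind : iIndepFun (fun (k : Fin n × Fin n) (ω : Ω) => X ω k.1 k.2) P)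
    (hsub : ∀ i j, HasSubgaussianMGF (fun ω => X ω i j) (1 / 4) P) :
    P.real {ω | ¬ ∀ v, ‖Matrix.toEuclideanLin (X ω) v‖ ≤ 8 * √n * ‖v‖} ≤ Real.exp (-n) := by
  obtain ⟨N, hcard, hN₁, hN⟩ := exists_half_net (EuclideanSpace ℝ (Fin n))
  rw [finrank_euclideanSpace_fin] at hcard
  have hsubset : {ω | ¬ ∀ v, ‖Matrix.toEuclideanLin (X ω) v‖ ≤ 8 * √n * ‖v‖} ⊆
      ⋃ p ∈ N ×ˢ N, {ω | 2 * √n ≤ inner ℝ p.1 (Matrix.toEuclideanLin (X ω) p.2)} := by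
    intro ω hω
    by_contra hcon
    simp only [Set.mem_iUnion, Finset.mem_product, Set.mem_ofPred_eq, not_exists, not_le] at hcon
    refine hω fun v => ?_
    have := opNorm_le_of_half_nets (t := 2 * √n) hN hN
      (Matrix.toEuclideanLin (X ω)).toContinuousLinearMap
      fun u hu v hv => (hcon (u, v) ⟨hu, hv⟩).le
    calc ‖Matrix.toEuclideanLin (X ω) v‖
        = ‖(Matrix.toEuclideanLin (X ω)).toContinuousLinearMap v‖ := rfl
      _ ≤ _ := ContinuousLinearMap.le_opNorm _ _
      _ ≤ _ := by gcongr; linarith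
  have hpt : ∀ p ∈ N ×ˢ N,
      P.real {ω | 2 * √n ≤ inner ℝ p.1 (Matrix.toEuclideanLin (X ω) p.2)} ≤
        Real.exp (-8 * n) := by
    intro p hp
    obtain ⟨h1, h2⟩ := Finset.mem_product.1 hp
    refine (measure_inner_ge_le hind hsub (hN₁ _ h1) (hN₁ _ h2) (by positivity)).trans_eq ?_
    rw [mul_pow, Real.sq_sqrt (by positivity)]
    push_cast
    congr 1
    ring
  -- The union bound costs `25 ^ n` pairs of net points; this keeps `exp (-n)` of the `exp (-8 n)`.
  have h25 : (25 : ℝ) ≤ Real.exp 7 := by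
    have h2 : (2 : ℝ) ≤ Real.exp 1 := by linarith [Real.add_one_le_exp (1 : ℝ)]
    calc (25 : ℝ) ≤ 2 ^ 7 := by norm_num
      _ ≤ Real.exp 1 ^ 7 := by gcongr
      _ = Real.exp 7 := by rw [← Real.exp_nat_mul]; norm_num
  calc P.real {ω | ¬ ∀ v, ‖Matrix.toEuclideanLin (X ω) v‖ ≤ 8 * √n * ‖v‖}
      ≤ P.real (⋃ p ∈ N ×ˢ N,
          {ω | 2 * √n ≤ inner ℝ p.1 (Matrix.toEuclideanLin (X ω) p.2)}) :=
        measureReal_mono hsubset (measure_ne_top _ _)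
    _ ≤ ∑ p ∈ N ×ˢ N, P.real {ω | 2 * √n ≤ inner ℝ p.1 (Matrix.toEuclideanLin (X ω) p.2)} :=
        measureReal_biUnion_finset_le _ _
    _ ≤ ∑ p ∈ N ×ˢ N, Real.exp (-8 * n) := Finset.sum_le_sum hpt
    _ = (N.card : ℝ) ^ 2 * Real.exp (-8 * n) := by
        rw [Finset.sum_const, Finset.card_product, nsmul_eq_mul]
        push_cast
        ring
    _ ≤ ((5 : ℝ) ^ n) ^ 2 * Real.exp (-8 * n) := by
        gcongr
        exact_mod_cast hcard
    _ = 25 ^ n * Real.exp (-8 * n) := by rw [← pow_mul, mul_comm n 2, pow_mul]; norm_num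
    _ ≤ Real.exp 7 ^ n * Real.exp (-8 * n) := by gcongr
    _ = Real.exp (-n) := by
        rw [← Real.exp_nat_mul, ← Real.exp_add]
        congr 1
        ring

theorem ae_eq_zero_or_one_of_hasLaw_bernoulli {Y : Ω → ℝ} {p : unitInterval}
    (h : HasLaw Y (bernoulliMeasure (1 : ℝ) 0 p) P) : ∀ᵐ ω ∂P, Y ω = 0 ∨ Y ω = 1 := by
  have hm : MeasurableSet {x : ℝ | x = 0 ∨ x = 1} := by measurability
  refine ae_of_ae_map h.aemeasurable (p := fun x => x = 0 ∨ x = 1) ?_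
  rw [h.map_eq, ae_iff]
  exact bernoulliMeasure_apply_of_notMem_of_notMem p hm.compl (by simp) (by simp)

theorem hasSubgaussianMGF_sub_of_hasLaw_bernoulli [IsProbabilityMeasure P] {Y : Ω → ℝ}
    {p : unitInterval} (h : HasLaw Y (bernoulliMeasure (1 : ℝ) 0 p) P) :
    HasSubgaussianMGF (fun ω => Y ω - p) (1 / 4) P := by
  have hmean : ∫ ω, Y ω ∂P = (p : ℝ) := by
    rw [h.integral_eq, integral_bernoulliMeasure]
    simp
  have hmem : ∀ᵐ ω ∂P, Y ω ∈ Set.Icc (0 : ℝ) 1 := by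
    filter_upwards [ae_eq_zero_or_one_of_hasLaw_bernoulli h] with ω hω
    rcases hω with hω | hω <;> simp [hω]
  have := hasSubgaussianMGF_of_mem_Icc h.aemeasurable hmem
  rw [hmean] at this
  convert! this using 1
  rw [← NNReal.coe_inj]
  push_cast
  norm_num

end Deviation

/-! ### From likelihood to error bounds -/

section BasicInequality

variable {n₁ n₂ n r : ℕ} {α₁ α₂ a K μ μs : ℝ}

theorem logLik_sigmoid {W : Matrix (Fin n₁) (Fin n₂) ℝ} (hW : ∀ i j, W i j = 0 ∨ W i j = 1)
    (M : Matrix (Fin n₁) (Fin n₂) ℝ) :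
    logLik Real.sigmoid W M = ∑ i, ∑ j, (W i j * M i j - Real.log (1 + Real.exp (M i j))) := by
  refine Finset.sum_congr rfl fun i _ => Finset.sum_congr rfl fun j _ => ?_
  rcases hW i j with h | h <;> simp [h, log_sigmoid, log_one_sub_sigmoid]

/-- The basic inequality: a matrix at least as likely as `M₀` is within a multiple of the correlation
with the noise `W - σ(M₀)` of it. -/
theorem frobenius_norm_sq_le_of_logLik_le {W M₀ M : Matrix (Fin n₁) (Fin n₂) ℝ}
    (hW : ∀ i j, W i j = 0 ∨ W i j = 1) (hM₀ : ∀ i j, |M₀ i j| ≤ a) (hM : ∀ i j, |M i j| ≤ a)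
    (h : logLik Real.sigmoid W M₀ ≤ logLik Real.sigmoid W M) :
    ‖M - M₀‖ ^ 2 ≤
      8 * Real.exp a * ∑ i, ∑ j, (W - M₀.map Real.sigmoid) i j * (M - M₀) i j := by
  rw [logLik_sigmoid hW, logLik_sigmoid hW, ← sub_nonneg, ← Finset.sum_sub_distrib] at h
  simp_rw [← Finset.sum_sub_distrib] at h
  have key : Real.exp (-a) / 8 * ‖M - M₀‖ ^ 2 ≤
      ∑ i, ∑ j, (W - M₀.map Real.sigmoid) i j * (M - M₀) i j := by
    rw [frobenius_norm_sq, Finset.mul_sum, ← sub_nonneg, ← Finset.sum_sub_distrib]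
    refine h.trans (Finset.sum_le_sum fun i _ => ?_)
    rw [Finset.mul_sum, ← Finset.sum_sub_distrib]
    refine Finset.sum_le_sum fun j _ => ?_
    have := log_one_add_exp_strong_convexity (hM₀ i j) (hM i j)
    simp only [Matrix.sub_apply, Matrix.map_apply]
    linarith
  calc ‖M - M₀‖ ^ 2 = 8 * Real.exp a * (Real.exp (-a) / 8 * ‖M - M₀‖ ^ 2) := by
        rw [Real.exp_neg]
        field_simp
    _ ≤ _ := by gcongr

theorem abs_predictor_le {Z : Matrix (Fin n₁) (Fin n₂) ℝ} (h : (μ, Z) ∈ paramSet n₁ n₂ α₁ α₂)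
    (i : Fin n₁) (j : Fin n₂) : |predictor μ Z i j| ≤ α₁ + α₂ := by
  have : predictor μ Z i j = μ + Z i j := by simp [predictor]
  rw [this]
  exact (abs_add_le _ _).trans (add_le_add h.1 (h.2.1 i j))

theorem frobenius_norm_sq_le_of_abs_le {A : Matrix (Fin n) (Fin n) ℝ} (h : ∀ i j, |A i j| ≤ a) :
    ‖A‖ ^ 2 ≤ a ^ 2 * n ^ 2 := by
  rw [frobenius_norm_sq]
  calc ∑ i, ∑ j, A i j ^ 2 ≤ ∑ _i : Fin n, ∑ _j : Fin n, a ^ 2 :=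
        Finset.sum_le_sum fun i _ => Finset.sum_le_sum fun j _ => sq_le_sq' (abs_le.1 (h i j)).1
          (abs_le.1 (h i j)).2
    _ = a ^ 2 * n ^ 2 := by simp; ring

theorem mem_constrainedParamSet_rank {Z : Matrix (Fin n) (Fin n) ℝ} (hα₂ : 0 ≤ α₂)
    (h : (μ, Z) ∈ paramSet n n α₁ α₂) : (μ, Z) ∈ constrainedParamSet n n Z.rank α₁ α₂ := by
  refine ⟨h, abs_le_of_sq_le_sq' ?_ (by positivity) |>.2⟩
  refine (nuclearNorm_sq_le Z).trans ?_
  rw [mul_pow, Real.sq_sqrt (by positivity)]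
  calc (Z.rank : ℝ) * ‖Z‖ ^ 2 ≤ Z.rank * (α₂ ^ 2 * n ^ 2) := by
        gcongr
        exact frobenius_norm_sq_le_of_abs_le h.2.1
    _ = α₂ ^ 2 * (Z.rank * n * n) := by ring

/-- Pythagoras: the cross term is a multiple of the entry sum of `Z - Zs`, which vanishes. -/
theorem frobenius_norm_sq_predictor_sub {Z Zs : Matrix (Fin n) (Fin n) ℝ}
    (hZ : ∑ i, ∑ j, Z i j = 0) (hZs : ∑ i, ∑ j, Zs i j = 0) :
    ‖predictor μ Z - predictor μs Zs‖ ^ 2 = n ^ 2 * (μs - μ) ^ 2 + ‖Z - Zs‖ ^ 2 := by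
  have h : ∀ i j, (predictor μ Z - predictor μs Zs) i j ^ 2 =
      (μs - μ) ^ 2 + (Z - Zs) i j ^ 2 + 2 * (μ - μs) * (Z i j - Zs i j) := by
    intro i j
    simp [predictor]
    ring
  simp_rw [frobenius_norm_sq, h, Finset.sum_add_distrib, ← Finset.mul_sum, Finset.sum_sub_distrib,
    hZ, hZs]
  simp
  ring

/-- The `J` part pairs with `X` as the quadratic form at the all-ones vector, of squared norm `n`.
`Z` and `Zs` are bounded separately, each by its own nuclear-norm constraint. -/
theorem sum_mul_predictor_sub_le {X Z Zs : Matrix (Fin n) (Fin n) ℝ} (hK : 0 ≤ K)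
    (hX : ∀ v, ‖Matrix.toEuclideanLin X v‖ ≤ K * ‖v‖)
    (h : (μ, Z) ∈ constrainedParamSet n n r α₁ α₂)
    (hs : (μs, Zs) ∈ constrainedParamSet n n r α₁ α₂) :
    ∑ i, ∑ j, X i j * (predictor μ Z - predictor μs Zs) i j ≤ 2 * K * n * (α₁ + α₂ * √r) := by
  have hsq : √((r : ℝ) * n * n) = √r * n := by
    rw [mul_assoc, Real.sqrt_mul (by positivity), Real.sqrt_mul_self (by positivity)]
  have hone : |∑ i, ∑ j, X i j| ≤ K * n := by
    set u : EuclideanSpace ℝ (Fin n) := WithLp.toLp 2 fun _ => 1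
    have hu : ‖u‖ ^ 2 = n := by simp [u, EuclideanSpace.real_norm_sq_eq]
    have : ∑ i, ∑ j, X i j = inner ℝ u (Matrix.toEuclideanLin X u) := by
      simp [u, PiLp.inner_apply, Matrix.toLpLin_apply, Matrix.mulVec, dotProduct]
    rw [this, ← hu]
    calc _ ≤ ‖u‖ * ‖Matrix.toEuclideanLin X u‖ := abs_real_inner_le_norm _ _
      _ ≤ ‖u‖ * (K * ‖u‖) := by gcongr; exact hX u
      _ = K * ‖u‖ ^ 2 := by ring
  have hnuc : ∀ {m : ℝ} {A : Matrix (Fin n) (Fin n) ℝ},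
      (m, A) ∈ constrainedParamSet n n r α₁ α₂ →
      |∑ i, ∑ j, X i j * A i j| ≤ K * (α₂ * (√r * n)) := fun hA =>
    (sum_mul_le_mul_nuclearNorm X _ hX).trans
      (mul_le_mul_of_nonneg_left (hsq ▸ hA.2) hK)
  have hμ : |μ - μs| ≤ 2 * α₁ := by
    linarith [abs_sub μ μs, h.1.1, hs.1.1]
  have hsplit : ∑ i, ∑ j, X i j * (predictor μ Z - predictor μs Zs) i j =
      (μ - μs) * ∑ i, ∑ j, X i j + ∑ i, ∑ j, X i j * Z i j - ∑ i, ∑ j, X i j * Zs i j := by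
    simp_rw [Finset.mul_sum, ← Finset.sum_add_distrib, ← Finset.sum_sub_distrib]
    refine Finset.sum_congr rfl fun i _ => Finset.sum_congr rfl fun j _ => ?_
    simp [predictor]
    ring
  have h1 : (μ - μs) * ∑ i, ∑ j, X i j ≤ 2 * α₁ * (K * n) := by
    refine (le_abs_self _).trans ?_
    rw [abs_mul]
    exact mul_le_mul hμ hone (abs_nonneg _) ((abs_nonneg _).trans hμ)
  have h2 := (le_abs_self _).trans (hnuc h)
  have h3 := (neg_le_abs _).trans (hnuc hs)
  rw [hsplit]
  linarith

/-- The three error bounds, on the event that the noise has operator norm at most `8 √n`. -/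
theorem error_bounds_of_opNorm_le (hn : 0 < n) {W Z Zs : Matrix (Fin n) (Fin n) ℝ}
    (hW : ∀ i j, W i j = 0 ∨ W i j = 1) (hs : (μs, Zs) ∈ paramSet n n α₁ α₂)
    (hX : ∀ v, ‖Matrix.toEuclideanLin (W - (predictor μs Zs).map Real.sigmoid) v‖ ≤
      8 * √n * ‖v‖)
    (hmle : IsConstrainedMLE Real.sigmoid W Zs.rank α₁ α₂ μ Z) :
    (μs - μ) ^ 2 ≤ 128 * min (α₁ ^ 2) (gammaRate n Zs.rank α₁ α₂) ∧
    ‖Z - Zs‖ ^ 2 / (n : ℝ) ^ 2 ≤ 128 * min (α₂ ^ 2) (gammaRate n Zs.rank α₁ α₂) ∧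
    ‖predictor μ Z - predictor μs Zs‖ ^ 2 / (n : ℝ) ^ 2 ≤
      128 * min ((α₁ + α₂) ^ 2) (gammaRate n Zs.rank α₁ α₂) := by
  obtain ⟨hmem, hmax⟩ := hmle
  have hα₂ : 0 ≤ α₂ := (abs_nonneg _).trans (hs.2.1 ⟨0, hn⟩ ⟨0, hn⟩)
  have hmem₀ := mem_constrainedParamSet_rank hα₂ hs
  have hn' : (0 : ℝ) < n := by exact_mod_cast hn
  have hlik : logLik Real.sigmoid W (predictor μs Zs) ≤ logLik Real.sigmoid W (predictor μ Z) :=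
    isMaxOn_iff.1 hmax (μs, Zs) hmem₀
  have hrate : ‖predictor μ Z - predictor μs Zs‖ ^ 2 ≤
      128 * gammaRate n Zs.rank α₁ α₂ * n ^ 2 := by
    calc ‖predictor μ Z - predictor μs Zs‖ ^ 2
        ≤ 8 * Real.exp (α₁ + α₂) * ∑ i, ∑ j, (W - (predictor μs Zs).map Real.sigmoid) i j *
            (predictor μ Z - predictor μs Zs) i j :=
          frobenius_norm_sq_le_of_logLik_le hW (abs_predictor_le hs) (abs_predictor_le hmem.1)
            hlik
      _ ≤ 8 * Real.exp (α₁ + α₂) * (2 * (8 * √n) * n * (α₁ + α₂ * √Zs.rank)) := by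
          gcongr
          exact sum_mul_predictor_sub_le (by positivity) hX hmem hmem₀
      _ = 128 * gammaRate n Zs.rank α₁ α₂ * n ^ 2 := by
          rw [gammaRate]
          field_simp
          rw [Real.sq_sqrt hn'.le]
          ring
  have hpyth := frobenius_norm_sq_predictor_sub (μ := μ) (μs := μs) hmem.1.2.2 hs.2.2
  -- The constant `128 = 8 * 2 * 8` comes from the rate; the trivial bound needs only 4.
  have bound : ∀ {A : Matrix (Fin n) (Fin n) ℝ} {b : ℝ}, (∀ i j, |A i j| ≤ 2 * b) →
      ‖A‖ ^ 2 ≤ 128 * gammaRate n Zs.rank α₁ α₂ * n ^ 2 →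
      ‖A‖ ^ 2 / (n : ℝ) ^ 2 ≤ 128 * min (b ^ 2) (gammaRate n Zs.rank α₁ α₂) := by
    intro A b h1 h2
    rw [div_le_iff₀ (by positivity), mul_min_of_nonneg _ _ (by norm_num),
      min_mul_of_nonneg _ _ (by positivity)]
    refine le_min ((frobenius_norm_sq_le_of_abs_le h1).trans ?_) h2
    gcongr
    nlinarith [sq_nonneg b]
  refine ⟨?_, bound (fun i j => ?_) (by nlinarith [sq_nonneg ((n : ℝ) * (μs - μ))]),
    bound (fun i j => ?_) hrate⟩
  · rw [mul_min_of_nonneg _ _ (by norm_num)]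
    refine le_min ?_ ?_
    · have h1 := sq_le_sq' (abs_le.1 hmem.1.1).1 (abs_le.1 hmem.1.1).2
      have h2 := sq_le_sq' (abs_le.1 hs.1).1 (abs_le.1 hs.1).2
      nlinarith [sq_nonneg (μs + μ)]
    · refine le_of_mul_le_mul_right ?_ (pow_pos hn' 2)
      nlinarith [sq_nonneg ‖Z - Zs‖]
  · rw [Matrix.sub_apply]
    linarith [abs_sub (Z i j) (Zs i j), hmem.1.2.1 i j, hs.2.1 i j]
  · rw [Matrix.sub_apply]
    linarith [abs_sub (predictor μ Z i j) (predictor μs Zs i j), abs_predictor_le hs i j,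
      abs_predictor_le hmem.1 i j]

end BasicInequality

end LowRankMissing

theorem mainTheorem3 :
    ∃ C₁ C₂ : ℝ, 0 < C₁ ∧ 0 < C₂ ∧
      ∀ (n : ℕ), 0 < n →
      ∀ (Ω : Type*) [MeasurableSpace Ω] (P : Measure Ω) [IsProbabilityMeasure P]
        (α₁ α₂ μs : ℝ) (Zs : Matrix (Fin n) (Fin n) ℝ)
        (W : Ω → Matrix (Fin n) (Fin n) ℝ)
        (muHat : Ω → ℝ) (ZHat : Ω → Matrix (Fin n) (Fin n) ℝ),
        (μs, Zs) ∈ LowRankMissing.paramSet n n α₁ α₂ →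
        iIndepFun (fun (k : Fin n × Fin n) (ω : Ω) => W ω k.1 k.2) P →
        (∀ i j, HasLaw (fun ω => W ω i j)
          (bernoulliMeasure (1 : ℝ) 0
            (unitInterval.sigmoid (LowRankMissing.predictor μs Zs i j))) P) →
        (∀ᵐ ω ∂P, LowRankMissing.IsConstrainedMLE Real.sigmoid (W ω) Zs.rank α₁ α₂
          (muHat ω) (ZHat ω)) →
        1 - C₁ / (n : ℝ) ≤ P.real {ω |
          (μs - muHat ω) ^ 2
              ≤ C₂ * min (α₁ ^ 2) (LowRankMissing.gammaRate n Zs.rank α₁ α₂) ∧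
          ‖ZHat ω - Zs‖ ^ 2 / (n : ℝ) ^ 2
              ≤ C₂ * min (α₂ ^ 2) (LowRankMissing.gammaRate n Zs.rank α₁ α₂) ∧
          ‖LowRankMissing.predictor (muHat ω) (ZHat ω) - LowRankMissing.predictor μs Zs‖ ^ 2
                / (n : ℝ) ^ 2
              ≤ C₂ * min ((α₁ + α₂) ^ 2)
                  (LowRankMissing.gammaRate n Zs.rank α₁ α₂)} := by
  refine ⟨1, 128, one_pos, by norm_num, ?_⟩
  intro n hn Ω _ P _ α₁ α₂ μs Zs W muHat ZHat hs hind hlaw hmle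
  set X : Ω → Matrix (Fin n) (Fin n) ℝ := fun ω =>
    W ω - (LowRankMissing.predictor μs Zs).map Real.sigmoid
  have hindX : iIndepFun (fun (k : Fin n × Fin n) (ω : Ω) => X ω k.1 k.2) P :=
    hind.comp (fun k x => x - Real.sigmoid (LowRankMissing.predictor μs Zs k.1 k.2))
      fun k => measurable_id.sub_const _
  have hdev := LowRankMissing.measure_opNorm_gt_le hindX fun i j =>
    LowRankMissing.hasSubgaussianMGF_sub_of_hasLaw_bernoulli (hlaw i j)
  have hW : ∀ᵐ ω ∂P, ∀ i j, W ω i j = 0 ∨ W ω i j = 1 :=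
    ae_all_iff.2 fun i => ae_all_iff.2 fun j =>
      LowRankMissing.ae_eq_zero_or_one_of_hasLaw_bernoulli (hlaw i j)
  set B := {ω | ¬ ∀ v, ‖Matrix.toEuclideanLin (X ω) v‖ ≤ 8 * √n * ‖v‖}
  have hexp : Real.exp (-n) ≤ 1 / (n : ℝ) := by
    rw [Real.exp_neg, ← one_div]
    refine one_div_le_one_div_of_le (by exact_mod_cast hn) ?_
    linarith [Real.add_one_le_exp (n : ℝ)]
  -- Subadditivity suffices here, so `B` need not be measurable.
  have hcover : (1 : ℝ) ≤ P.real Bᶜ + P.real B := by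
    have := measureReal_union_le (μ := P) Bᶜ B
    rwa [Set.compl_union_self, probReal_univ] at this
  have hgood := ENNReal.toReal_mono (measure_ne_top P _) (measure_mono_ae (μ := P) (s := Bᶜ) <| by
    filter_upwards [hW, hmle] with ω h1 h2 hω
    exact LowRankMissing.error_bounds_of_opNorm_le hn h1 hs (not_not.1 hω) h2)
  have hB : 1 - 1 / (n : ℝ) ≤ P.real Bᶜ := by linarith
  exact hB.trans hgood
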